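/- For integers $q\ge 1$, $n\ge 1$, the symbol weight of a word $x\in\{0,\dots,q-1\}^n$ is the largest number of times that a symbol occurs in $x$. Let $A_q^{SW}(n,d,r)$ (respectively $A_q^{SW}(n,d,\le r)$) be the maximum size of a code in $\{0,\dots,q-1\}^n$ with minimum Hamming distance at least $d$ all of whose words have symbol weight exactly $r$ (respectively at most $r$). For $q\ge2$ and $0\le x\le1$ put $$h_q(x)=-x\log_q\frac{x}{q-1}-(1-x)\log_q(1-x),\qquad 0\log_q 0=0 .$$ Let $d=d_n$ and $r=r_n$ be sequences of non-negative integers with $d_n/n\to\delta>0$. Assume that, for all large $n$, $r_n\ge\lceil n/q\rceil$, and also $r_n\le n$ in the statements on $A_q^{SW}(n,d,r)$ (so that the spaces of words are non-empty). (a) Let $q\ge2$ be constant and $\delta\le\frac{q-1}{q}$. Then $$\liminf_{n\to\infty}\frac1n\log_qA_q^{SW}(n,d,r)\ \ge\ h_q(1-\rho)-h_q(\delta)\quad\text{if } r_n/n\to\rho,$$ $$\liminf_{n\to\infty}\frac1n\log_qA_q^{SW}(n,d,\le r)\ \ge\ 1-h_q(\delta)\quad\text{for any such } r.$$ (b) Let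 $q=q_n$ be a sequence of positive integers with $q_n\sim\theta n^{\epsilon}$ as $n\to\infty$, for constants $\theta>0$ and $0<\epsilon\le1$, and let $\delta\le 1$. Then $$\liminf_{n\to\infty}\frac1n\log_qA_q^{SW}(n,d,r)\ \ge\ 1-\rho-\delta\quad\text{if } r_n/n\to\rho,$$ $$\lim_{n\to\infty}\frac1n\log_qA_q^{SW}(n,d,r)=1-\delta\quad\text{if } r_n=o(n),$$ $$\lim_{n\to\infty}\frac1n\log_qA_q^{SW}(n,d,\le r)=1-\delta\quad\text{for any such } r.$$ -/

import Mathlib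

open Filter Topology Asymptotics

/-- The symbol weight of a word `x` of length `n` over the alphabet `{0, …, q - 1}`: the maximum of
the frequencies of occurrence of the symbols in `x`. -/
def symbolWeight {n q : ℕ} (x : Fin n → Fin q) : ℕ :=
  Finset.univ.sup fun a : Fin q => (Finset.univ.filter fun i : Fin n => x i = a).card

/-- The constant symbol weight space: all words of symbol weight exactly `r`. -/
def constSW (n q r : ℕ) : Finset (Fin n → Fin q) :=
  Finset.univ.filter fun x => symbolWeight x = r

/-- The bounded symbol weight space: all words of symbol weight at most `r`. -/
def boundedSW (n q r : ℕ) : Finset (Fin n → Fin q) :=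
  Finset.univ.filter fun x => symbolWeight x ≤ r

/-- The maximum size of a code contained in `S` with minimum Hamming distance at least `d`. -/
def maxCodeSize {n q : ℕ} (S : Finset (Fin n → Fin q)) (d : ℕ) : ℕ :=
  (S.powerset.filter fun C => ∀ x ∈ C, ∀ y ∈ C, x ≠ y → d ≤ hammingDist x y).sup Finset.card

/-- The maximum size of a constant symbol weight code with symbol weight `r`, length `n` and
distance `d` over an alphabet of `q` symbols. -/
def constSWMax (q n d r : ℕ) : ℕ := maxCodeSize (constSW n q r) d

/-- The maximum size of a bounded symbol weight code with symbol weight at most `r`, length `n` and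
distance `d` over an alphabet of `q` symbols. -/
def boundedSWMax (q n d r : ℕ) : ℕ := maxCodeSize (boundedSW n q r) d

/-- The rate `(1 / n) log_q A` of a code of size `A` and length `n` over `q` symbols. -/
noncomputable def codeRate (q n A : ℕ) : ℝ := 1 / (n : ℝ) * Real.logb q A

/-- The `q`-ary entropy function with logarithms to base `q`. Mathlib's `Real.qaryEntropy` uses
natural logarithms. -/
noncomputable def entropyBase (q : ℕ) (x : ℝ) : ℝ := Real.qaryEntropy q x / Real.log q

/-- The entropy function written out with logarithms to base `q`. -/
theorem entropyBase_eq {q : ℕ} (hq : 2 ≤ q) (x : ℝ) :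
    entropyBase q x =
      -x * Real.logb q (x / ((q : ℝ) - 1)) - (1 - x) * Real.logb q (1 - x) := by
  have h1 : ((q : ℝ) - 1) ≠ 0 := by
    have : (2 : ℝ) ≤ q := by exact_mod_cast hq
    linarith
  unfold entropyBase Real.qaryEntropy Real.logb
  rw [Real.binEntropy_eq_negMulLog_add_negMulLog_one_sub]
  unfold Real.negMulLog
  push_cast
  by_cases hx : x = 0
  · simp [hx]
  · rw [Real.log_div hx h1]
    ring

/-! The lower bounds are Gilbert–Varshamov bounds inside the space of words. A largest code `C` in
`S` covers `S` with balls of radius `d`, and for `0 < z ≤ 1` a Chernoff weighting `z ^ hammingDist`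
replaces the ball size by `(1 + (q - 1) z) ^ n / z ^ d` (`card_mul_pow_le_maxCodeSize_mul`). The
space itself is bounded below by one orbit under coordinate permutations, a multinomial coefficient
with one part `r` and the rest balanced (`log_card_constSW_ge`).

For constant `q` the optimal `z` turns the ball term into `h_q(δ)`. For growing `q`, `z = 1 / q`
suffices: every error is `O(n)`, hence negligible against `n log q`, and the Singleton bound
`maxCodeSize_le_pow` gives the matching upper bound `1 - δ`. Bounded weight codes contain the
constant weight codes with `r = ⌈n / q⌉`, whose space already has full rate. -/

/-! ### Gilbert–Varshamov and Singleton bounds. -/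

theorem sum_pow_hammingDist {n q : ℕ} (x : Fin n → Fin q) (z : ℝ) :
    ∑ y : Fin n → Fin q, z ^ hammingDist x y = (1 + ((q : ℝ) - 1) * z) ^ n := by
  have h1 : ∀ y : Fin n → Fin q,
      z ^ hammingDist x y = ∏ i, (if x i = y i then (1 : ℝ) else z) := by
    intro y
    rw [hammingDist, Finset.prod_ite]
    simp
  have h2 : ∀ i, ∑ a : Fin q, (if x i = a then (1 : ℝ) else z) = 1 + ((q : ℝ) - 1) * z := by
    intro i
    have : ∀ a : Fin q, (if x i = a then (1 : ℝ) else z) = z + (if x i = a then 1 - z else 0) := by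
      intro a; split_ifs <;> ring
    simp only [this, Finset.sum_add_distrib, Finset.sum_ite_eq, Finset.mem_univ, if_true,
      Finset.sum_const, Finset.card_univ, Fintype.card_fin, nsmul_eq_mul]
    ring
  simp only [h1]
  rw [← Fintype.prod_sum (fun i a => if x i = a then (1 : ℝ) else z)]
  simp [h2]

theorem exists_code_card_eq_maxCodeSize {n q : ℕ} (S : Finset (Fin n → Fin q)) (d : ℕ) :
    ∃ C ⊆ S, (∀ x ∈ C, ∀ y ∈ C, x ≠ y → d ≤ hammingDist x y) ∧ C.card = maxCodeSize S d := by
  obtain ⟨C, hC, h⟩ := Finset.exists_mem_eq_sup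
    (S.powerset.filter fun C => ∀ x ∈ C, ∀ y ∈ C, x ≠ y → d ≤ hammingDist x y)
    ⟨∅, by simp⟩ Finset.card
  simp only [Finset.mem_filter, Finset.mem_powerset] at hC
  exact ⟨C, hC.1, hC.2, h.symm⟩

theorem card_le_maxCodeSize {n q d : ℕ} {S C : Finset (Fin n → Fin q)} (hCS : C ⊆ S)
    (hC : ∀ x ∈ C, ∀ y ∈ C, x ≠ y → d ≤ hammingDist x y) : C.card ≤ maxCodeSize S d :=
  Finset.le_sup (f := Finset.card) (by simpa using ⟨hCS, hC⟩)

theorem maxCodeSize_mono {n q d : ℕ} {S T : Finset (Fin n → Fin q)} (h : S ⊆ T) :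
    maxCodeSize S d ≤ maxCodeSize T d := by
  obtain ⟨C, hC, hd, hc⟩ := exists_code_card_eq_maxCodeSize S d
  exact hc ▸ card_le_maxCodeSize (hC.trans h) hd

/-- The Gilbert–Varshamov bound, with the ball sizes estimated by the weight enumerator. -/
theorem card_mul_pow_le_maxCodeSize_mul {n q d : ℕ} (S : Finset (Fin n → Fin q))
    {z : ℝ} (hz : 0 < z) (hz1 : z ≤ 1) :
    (S.card : ℝ) * z ^ d ≤ maxCodeSize S d * (1 + ((q : ℝ) - 1) * z) ^ n := by
  obtain ⟨C, hC, hdist, hcard⟩ := exists_code_card_eq_maxCodeSize S d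
  have hcover : ∀ x ∈ S, ∃ c ∈ C, hammingDist c x ≤ d := by
    intro x hx
    by_contra! hfar
    have hxC : x ∉ C := fun h => by simpa using hfar x h
    have := card_le_maxCodeSize (C := insert x C) (d := d)
      (Finset.insert_subset hx hC) (by
        intro a ha b hb hab
        rw [Finset.mem_insert] at ha hb
        rcases ha with rfl | ha <;> rcases hb with rfl | hb
        · exact absurd rfl hab
        · rw [hammingDist_comm]; exact (hfar b hb).le
        · exact (hfar a ha).le
        · exact hdist a ha b hb hab)
    rw [Finset.card_insert_of_notMem hxC, hcard] at this
    omega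
  calc (S.card : ℝ) * z ^ d = ∑ x ∈ S, z ^ d := by simp
    _ ≤ ∑ x ∈ S, ∑ c ∈ C, z ^ hammingDist c x := by
        refine Finset.sum_le_sum fun x hx => ?_
        obtain ⟨c, hc, hcx⟩ := hcover x hx
        exact (pow_le_pow_of_le_one hz.le hz1 hcx).trans
          (Finset.single_le_sum (f := fun c => z ^ hammingDist c x)
            (fun _ _ => by positivity) hc)
    _ ≤ ∑ x, ∑ c ∈ C, z ^ hammingDist c x :=
        Finset.sum_le_sum_of_subset_of_nonneg (Finset.subset_univ _)
          fun _ _ _ => Finset.sum_nonneg fun _ _ => by positivity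
    _ = maxCodeSize S d * (1 + ((q : ℝ) - 1) * z) ^ n := by
        rw [Finset.sum_comm]
        simp [sum_pow_hammingDist, hcard]

/-- The Singleton bound. -/
theorem maxCodeSize_le_pow {n q : ℕ} (S : Finset (Fin n → Fin q)) (d : ℕ) :
    maxCodeSize S d ≤ q ^ (n - (d - 1)) := by
  obtain ⟨C, -, hdist, hcard⟩ := exists_code_card_eq_maxCodeSize S d
  have hle : n - (d - 1) ≤ n := Nat.sub_le _ _
  rw [← hcard]
  have := Finset.card_le_card_of_injOn (s := C)
    (t := (Finset.univ : Finset (Fin (n - (d - 1)) → Fin q)))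
    (fun x i => x (Fin.castLE hle i)) (by simp) (by
      intro x hx y hy hxy
      by_contra hne
      have h1 := hdist x hx y hy hne
      have h2 : hammingDist x y ≤ n - (n - (d - 1)) := by
        have : hammingDist x y ≤
            (Finset.univ.filter fun i : Fin n => ¬ (i : ℕ) < n - (d - 1)).card := by
          refine Finset.card_le_card fun i hi => ?_
          simp only [Finset.mem_filter, Finset.mem_univ, true_and] at hi ⊢
          exact fun hlt => hi (congrFun hxy ⟨i, hlt⟩)
        have h3 := Finset.card_filter_add_card_filter_not (s := (Finset.univ : Finset (Fin n)))
          (fun i : Fin n => (i : ℕ) < n - (d - 1))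
        have h4 : (Finset.univ.filter fun i : Fin n => (i : ℕ) < n - (d - 1)).card
            = n - (d - 1) := by
          rw [Fin.card_filter_val_lt]; omega
        rw [h4, Finset.card_univ, Fintype.card_fin] at h3
        omega
      -- This settles `d = 0`, where truncated subtraction makes `d - 1 = 0` and `h1` is vacuous.
      have h5 : 0 < hammingDist x y := hammingDist_pos.2 hne
      omega)
  simpa using this

/-! ### Size of the constant symbol weight space. -/

/-- Permuting the coordinates of a word yields many words of the same symbol weight. -/
theorem factorial_le_card_constSW_mul {n q : ℕ} (f : Fin n → Fin q) :
    n.factorial ≤ (constSW n q (symbolWeight f)).card *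
      ∏ a, (Finset.univ.filter fun i => f i = a).card.factorial := by
  have hmaps : ∀ g ∈ (Finset.univ : Finset (Equiv.Perm (Fin n))),
      f ∘ g ∈ constSW n q (symbolWeight f) := by
    intro g _
    rw [constSW, Finset.mem_filter]
    exact ⟨Finset.mem_univ _, Finset.sup_congr rfl fun a _ => Finset.card_equiv g (by simp)⟩
  -- Each nonempty fibre of `g ↦ f ∘ g` is a coset of the stabilizer of `f`, whose order is the
  -- product of the factorials.
  have h := Finset.card_le_mul_card_image_of_maps_to hmaps
    (∏ a, (Finset.univ.filter fun i => f i = a).card.factorial) (by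
      intro y _
      by_cases hy : ∃ g₀ : Equiv.Perm (Fin n), f ∘ g₀ = y
      · obtain ⟨g₀, rfl⟩ := hy
        have hs := DomMulAct.stabilizer_card f
        simp only [Fintype.card_subtype] at hs
        rw [← hs]
        refine Finset.card_le_card_of_injOn (fun g => g * g₀⁻¹) ?_
          (fun a _ b _ hab => by simpa using hab)
        intro g hg
        simp only [Finset.coe_filter, Finset.mem_univ, true_and, Set.mem_ofPred_eq] at hg ⊢
        ext i
        have := congrFun hg (g₀⁻¹ i)
        simpa using congrArg Fin.val this
      · rw [Finset.filter_false_of_mem (fun g _ h => hy ⟨g, h⟩)]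
        simp)
  simpa [Fintype.card_perm, mul_comm] using h

/-- The linear term `-k` must be kept: summed over all symbols it cancels the `-n` coming from `n!`.
Writing `log (k + 1)` lets the bound include `k = 0`. -/
theorem log_factorial_le (k : ℕ) :
    Real.log k.factorial ≤ k * Real.log k - k + 1 + Real.log (k + 1) := by
  rcases Nat.eq_zero_or_pos k with rfl | hk
  · simp
  have key : Real.log k.factorial ≤ k * Real.log k - k + 1 + Real.log k := by
    induction k, hk using Nat.le_induction with
    | base => simp
    | succ k hk ih =>
      have hk0 : (0 : ℝ) < k := by exact_mod_cast hk
      have h1 := Real.one_sub_inv_le_log_of_pos (x := ((k : ℝ) + 1) / k) (by positivity)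
      rw [Real.log_div (by positivity) hk0.ne', inv_div] at h1
      have h2 := mul_le_mul_of_nonneg_left h1 (by positivity : (0 : ℝ) ≤ k + 1)
      have h3 : ((k : ℝ) + 1) * (1 - k / (k + 1)) = 1 := by field_simp; ring
      rw [Nat.factorial_succ, Nat.cast_mul,
        Real.log_mul (by positivity) (by positivity)]
      push_cast
      nlinarith
  have : Real.log k ≤ Real.log (k + 1) :=
    Real.log_le_log (by exact_mod_cast hk) (by linarith)
  linarith

theorem le_log_factorial (n : ℕ) : n * Real.log n - n ≤ Real.log n.factorial := by
  rcases Nat.eq_zero_or_pos n with rfl | hn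
  · simp
  have hn0 : (0 : ℝ) < n := by exact_mod_cast hn
  have h := Real.log_le_log (by positivity) (Real.pow_div_factorial_le_exp (n : ℝ) hn0.le n)
  rw [Real.log_exp, Real.log_div (by positivity) (by positivity), Real.log_pow] at h
  linarith

/-- A word with `r` symbols `0` whose other symbols are as evenly distributed as possible. -/
theorem exists_word_fiber_card {n s r : ℕ} (hs : 0 < s) (hr : r ≤ n) (hn : n ≤ (s + 1) * r) :
    ∃ f : Fin n → Fin (s + 1), symbolWeight f = r ∧
      (Finset.univ.filter fun i => f i = 0).card = r ∧
      ∀ c : Fin s, (Finset.univ.filter fun i => f i = c.succ).card ≤ (n - r + s - 1) / s := by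
  set f : Fin n → Fin (s + 1) := fun i =>
    if (i : ℕ) < r then 0 else (⟨(i - r) % s, Nat.mod_lt _ hs⟩ : Fin s).succ with hf
  have h0 : (Finset.univ.filter fun i => f i = 0).card = r := by
    have : (Finset.univ.filter fun i => f i = 0)
        = Finset.univ.filter fun i : Fin n => (i : ℕ) < r := by
      ext i
      by_cases h : (i : ℕ) < r <;> simp [hf, h]
    rw [this, Fin.card_filter_val_lt]
    omega
  have hc : ∀ c : Fin s,
      (Finset.univ.filter fun i => f i = c.succ).card ≤ (n - r + s - 1) / s := by
    intro c
    have hmem : ∀ i, f i = c.succ → r ≤ (i : ℕ) ∧ (i - r) % s = c := by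
      intro i hi
      by_cases h : (i : ℕ) < r
      · simp [hf, h, (Fin.succ_ne_zero _).symm] at hi
      · simp only [hf, h, if_false, Fin.succ_inj] at hi
        exact ⟨not_lt.1 h, congrArg Fin.val hi⟩
    rw [← Finset.card_range ((n - r + s - 1) / s)]
    refine Finset.card_le_card_of_injOn (fun i => ((i : ℕ) - r) / s) ?_ ?_
    · intro i hi
      have hi := hmem i (by simpa using hi)
      have := i.2
      simp only [Finset.coe_range, Set.mem_Iio]
      rw [Nat.div_lt_iff_lt_mul hs]
      have h1 := Nat.div_add_mod (n - r + s - 1) s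
      have h2 := Nat.mod_lt (n - r + s - 1) hs
      rw [mul_comm s] at h1
      omega
    · intro i hi j hj hij
      have hi := hmem i (by simpa using hi)
      have hj := hmem j (by simpa using hj)
      have h1 := Nat.div_add_mod ((i : ℕ) - r) s
      have h2 := Nat.div_add_mod ((j : ℕ) - r) s
      simp only at hij
      rw [hij, hi.2] at h1
      rw [hj.2] at h2
      ext
      omega
  -- The hypothesis `hn` says that the other `s` symbols can absorb `n - r` positions without any
  -- exceeding `r`.
  have hK : (n - r + s - 1) / s ≤ r := by
    rw [← Nat.lt_succ_iff, Nat.div_lt_iff_lt_mul hs]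
    have h1 : (s + 1) * r = s * r + r := by ring
    have h2 : (r + 1) * s = s * r + s := by ring
    simp only [Nat.succ_eq_add_one]
    omega
  refine ⟨f, le_antisymm (Finset.sup_le fun a _ => ?_) ?_, h0, hc⟩
  · induction a using Fin.cases with
    | zero => exact h0.le
    | succ c => exact (hc c).trans hK
  · exact h0.symm.le.trans
      (Finset.le_sup (f := fun a => (Finset.univ.filter fun i => f i = a).card)
        (Finset.mem_univ 0))

/-- Rounding the average `m / s` up to `K` costs only an additive `s`, by `log t ≤ t - 1` with `t =
K s / m`. For `K = 0` the convention `log 0 = 0` leaves `m log (s / m) ≤ s`. -/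
theorem mul_log_le_of_mul_le_add {m s K : ℝ} (hm : 0 ≤ m) (hs : 0 < s) (hK : 0 ≤ K)
    (h : K * s ≤ m + s) : m * Real.log K ≤ m * Real.log m - m * Real.log s + s := by
  rcases hm.eq_or_lt with rfl | hm
  · simpa using hs.le
  rcases hK.eq_or_lt with rfl | hK
  · have h1 := Real.add_one_le_exp (Real.log (s / m))
    have h2 : Real.log (s / m) ≤ s / m := by
      rw [Real.exp_log (by positivity)] at h1; linarith
    rw [Real.log_div hs.ne' hm.ne', le_div_iff₀ hm] at h2
    simp only [Real.log_zero]
    nlinarith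
  · have h1 := Real.log_le_sub_one_of_pos (x := K * s / m) (by positivity)
    rw [Real.log_div (by positivity) hm.ne', Real.log_mul hK.ne' hs.ne'] at h1
    have h2 := mul_le_mul_of_nonneg_left h1 hm.le
    have h3 : m * (K * s / m - 1) = K * s - m := by field_simp
    rw [h3] at h2
    nlinarith

/-- The size of the constant symbol weight space with symbol weight `r`, from below. -/
theorem log_card_constSW_ge {n s r : ℕ} (hs : 0 < s) (hr : r ≤ n) (hn : n ≤ (s + 1) * r) :
    (n * Real.log n - r * Real.log r - ((n : ℝ) - r) * Real.log ((n : ℝ) - r)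
      + ((n : ℝ) - r) * Real.log s)
      - (s + (1 + Real.log (n + 1)) + s * (1 + Real.log (n / s + 2)))
      ≤ Real.log (constSW n (s + 1) r).card ∧ 0 < (constSW n (s + 1) r).card := by
  obtain ⟨f, hw, h0, hc⟩ := exists_word_fiber_card hs hr hn
  have hmain := factorial_le_card_constSW_mul f
  rw [hw, Fin.prod_univ_succ, h0] at hmain
  set k : Fin s → ℕ := fun c => (Finset.univ.filter fun i => f i = c.succ).card with hk
  set K := (n - r + s - 1) / s with hKdef
  have hsum : r + ∑ c, k c = n := by
    have := Finset.card_eq_sum_card_fiberwise (f := f) (s := Finset.univ) (t := Finset.univ)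
      (by simp)
    rw [Fin.sum_univ_succ, h0] at this
    simpa using this.symm
  have hpos : 0 < (constSW n (s + 1) r).card := by
    by_contra h
    rw [not_lt, Nat.le_zero] at h
    rw [h, zero_mul] at hmain
    exact absurd (Nat.factorial_pos n) (by omega)
  refine ⟨?_, hpos⟩
  have hs0 : (0 : ℝ) < s := by exact_mod_cast hs
  have hrn : (r : ℝ) ≤ n := by exact_mod_cast hr
  have hKs : (K : ℝ) * s ≤ (n - r) + s := by
    have h1 : K * s ≤ n - r + s := by
      have : K * s ≤ n - r + s - 1 := Nat.div_mul_le_self _ _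
      omega
    have h2 : ((K * s : ℕ) : ℝ) ≤ ((n - r + s : ℕ) : ℝ) := by exact_mod_cast h1
    push_cast [Nat.cast_sub hr] at h2
    exact h2
  have hsumR : ∑ c, (k c : ℝ) = n - r := by
    have : ((r + ∑ c, k c : ℕ) : ℝ) = n := by rw [hsum]
    push_cast at this
    linarith
  have hlog : Real.log n.factorial ≤ Real.log (constSW n (s + 1) r).card
      + (Real.log r.factorial + ∑ c, Real.log (k c).factorial) := by
    have h1 := Real.log_le_log (by exact_mod_cast Nat.factorial_pos n)
      (Nat.cast_le (α := ℝ).2 hmain)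
    rw [Nat.cast_mul, Nat.cast_mul, Nat.cast_prod, Real.log_mul (by positivity) (by
        refine mul_ne_zero (by positivity) (Finset.prod_ne_zero_iff.2 fun c _ => by positivity)),
      Real.log_mul (by positivity) (Finset.prod_ne_zero_iff.2 fun c _ => by positivity),
      Real.log_prod (fun c _ => by positivity)] at h1
    exact h1
  have hterm : ∀ c, Real.log (k c).factorial
      ≤ k c * (Real.log K - 1) + (1 + Real.log (K + 1)) := by
    intro c
    have h1 := log_factorial_le (k c)
    have hkK : (k c : ℝ) ≤ K := by exact_mod_cast hc c
    have h2 : Real.log (k c + 1) ≤ Real.log (K + 1) :=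
      Real.log_le_log (by positivity) (by linarith)
    have h3 : (k c : ℝ) * Real.log (k c) ≤ k c * Real.log K := by
      rcases Nat.eq_zero_or_pos (k c) with h | h
      · simp [h]
      · exact mul_le_mul_of_nonneg_left
          (Real.log_le_log (by exact_mod_cast h) hkK) (by positivity)
    linarith
  have hterms : ∑ c, Real.log (k c).factorial
      ≤ ((n : ℝ) - r) * (Real.log K - 1) + s * (1 + Real.log (K + 1)) := by
    refine (Finset.sum_le_sum fun c _ => hterm c).trans_eq ?_
    rw [Finset.sum_add_distrib, ← Finset.sum_mul, hsumR]
    simp [mul_add]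
  have hmK := mul_log_le_of_mul_le_add (sub_nonneg.2 hrn) hs0 (Nat.cast_nonneg K) hKs
  have hr' := log_factorial_le r
  have hn' := le_log_factorial n
  have h1 : Real.log (r + 1) ≤ Real.log (n + 1) :=
    Real.log_le_log (by positivity) (by linarith)
  have h2 : (s : ℝ) * Real.log (K + 1) ≤ s * Real.log (n / s + 2) := by
    refine mul_le_mul_of_nonneg_left (Real.log_le_log (by positivity) ?_) hs0.le
    have h3 : (K : ℝ) ≤ n / s + 1 := by
      rw [div_add_one hs0.ne', le_div_iff₀ hs0]
      have : (0 : ℝ) ≤ r := by positivity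
      linarith
    linarith
  linarith

theorem mul_log_sub_eq_mul_binEntropy {n r : ℝ} (hn : 0 < n) :
    n * Real.log n - r * Real.log r - (n - r) * Real.log (n - r)
      = n * Real.binEntropy (r / n) := by
  have key : ∀ x : ℝ, n * Real.negMulLog (x / n) = x * Real.log n - x * Real.log x := by
    intro x
    by_cases hx : x = 0
    · simp [hx]
    · rw [Real.negMulLog, Real.log_div hx hn.ne']
      field_simp
      ring
  have h1 : 1 - r / n = (n - r) / n := by field_simp
  rw [Real.binEntropy_eq_negMulLog_add_negMulLog_one_sub, h1, mul_add, key, key]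
  ring

/-! ### Bounds on rates at finite length. -/

/-- A finite-length lower bound on the rate of optimal constant symbol weight codes. -/
theorem codeRate_constSWMax_ge {q n d r : ℕ} (hq : 2 ≤ q) (hn0 : 0 < n) (hr : r ≤ n)
    (hn : n ≤ q * r) {z : ℝ} (hz : 0 < z) (hz1 : z ≤ 1) :
    (n * Real.binEntropy (r / n) + ((n : ℝ) - r) * Real.log ((q : ℝ) - 1)
      - (((q : ℝ) - 1) + (1 + Real.log (n + 1))
        + ((q : ℝ) - 1) * (1 + Real.log (n / ((q : ℝ) - 1) + 2)))
      + d * Real.log z - n * Real.log (1 + ((q : ℝ) - 1) * z)) / (n * Real.log q)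
      ≤ codeRate q n (constSWMax q n d r) ∧ 0 < constSWMax q n d r := by
  obtain ⟨s, rfl⟩ : ∃ s, q = s + 1 := ⟨q - 1, by omega⟩
  obtain ⟨h1, hS⟩ := log_card_constSW_ge (by omega) hr hn
  have hn0' : (0 : ℝ) < n := by exact_mod_cast hn0
  have hgv := card_mul_pow_le_maxCodeSize_mul (d := d) (constSW n (s + 1) r) hz hz1
  rw [mul_log_sub_eq_mul_binEntropy hn0'] at h1
  have hq1 : ((s + 1 : ℕ) : ℝ) - 1 = s := by push_cast; ring
  rw [hq1] at hgv ⊢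
  have hS0 : (0 : ℝ) < (constSW n (s + 1) r).card := by exact_mod_cast hS
  have hA : 0 < constSWMax (s + 1) n d r := by
    rw [Nat.pos_iff_ne_zero]
    intro h
    rw [constSWMax] at h
    rw [h] at hgv
    have : 0 < ((constSW n (s + 1) r).card : ℝ) * z ^ d := by positivity
    simp at hgv
    linarith
  refine ⟨?_, hA⟩
  have hA0 : (0 : ℝ) < constSWMax (s + 1) n d r := by exact_mod_cast hA
  have h2 := Real.log_le_log (by positivity) hgv
  rw [Real.log_mul hS0.ne' (by positivity), Real.log_pow,
    Real.log_mul (by exact hA0.ne') (by positivity), Real.log_pow] at h2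
  have hlq : 0 < Real.log ((s + 1 : ℕ) : ℝ) := Real.log_pos (by exact_mod_cast hq)
  rw [codeRate, Real.logb, div_mul_div_comm, one_mul]
  refine div_le_div_of_nonneg_right ?_ (by positivity)
  rw [constSWMax]
  linarith

theorem codeRate_mono {q n A B : ℕ} (hq : 2 ≤ q) (hA : 0 < A) (h : A ≤ B) :
    codeRate q n A ≤ codeRate q n B := by
  unfold codeRate
  refine mul_le_mul_of_nonneg_left ?_ (by positivity)
  exact Real.logb_le_logb_of_le (by exact_mod_cast hq) (by exact_mod_cast hA)
    (by exact_mod_cast h)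

theorem constSWMax_le_boundedSWMax {q n d r' r : ℕ} (h : r' ≤ r) :
    constSWMax q n d r' ≤ boundedSWMax q n d r := by
  refine maxCodeSize_mono fun x hx => ?_
  simp only [constSW, boundedSW, Finset.mem_filter, Finset.mem_univ, true_and] at hx ⊢
  omega

theorem codeRate_maxCodeSize_le {q n d : ℕ} (hq : 2 ≤ q) (hn : 0 < n)
    (S : Finset (Fin n → Fin q)) (hA : 0 < maxCodeSize S d) :
    codeRate q n (maxCodeSize S d) ≤ max 0 (1 - (d : ℝ) / n + 1 / n) := by
  have hn0 : (0 : ℝ) < n := by exact_mod_cast hn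
  have h := (codeRate_mono (n := n) hq hA (maxCodeSize_le_pow S d))
  have h1 : codeRate q n (q ^ (n - (d - 1))) = ((n - (d - 1) : ℕ) : ℝ) / n := by
    rw [codeRate, Nat.cast_pow, Real.logb_pow,
      Real.logb_self_eq_one (by exact_mod_cast hq)]
    ring
  rw [h1] at h
  refine h.trans ?_
  -- For `d > n` the exponent truncates to `0`; this is what the `max 0` is for.
  by_cases hd : d ≤ n
  · refine le_max_of_le_right ?_
    have : (((n - (d - 1) : ℕ) : ℝ)) ≤ n - d + 1 := by
      have h2 : n - (d - 1) + d ≤ n + 1 := by omega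
      have h3 : ((n - (d - 1) + d : ℕ) : ℝ) ≤ ((n + 1 : ℕ) : ℝ) := by exact_mod_cast h2
      push_cast at h3
      linarith
    calc _ ≤ ((n : ℝ) - d + 1) / n := div_le_div_of_nonneg_right this hn0.le
      _ = _ := by field_simp
  · have : n - (d - 1) = 0 := by omega
    simp [this]

/-! ### Limits, and the constant alphabet. -/

theorem tendsto_log_mul_add_div_atTop {a : ℝ} (ha : 0 < a) (b : ℝ) :
    Tendsto (fun n : ℕ => Real.log (a * n + b) / n) atTop (𝓝 0) := by
  have h1 := Real.tendsto_pow_log_div_mul_add_atTop a⁻¹ (-(b / a)) 1 (by positivity)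
  have h2 : Tendsto (fun n : ℕ => a * (n : ℝ) + b) atTop atTop :=
    tendsto_atTop_add_const_right _ _ (tendsto_natCast_atTop_atTop.const_mul_atTop ha)
  refine (h1.comp h2).congr fun n => ?_
  have : a⁻¹ * (a * (n : ℝ) + b) + -(b / a) = n := by field_simp; ring
  simp [this]

theorem coe_le_liminf_of_tendsto {f g : ℕ → ℝ} {c : ℝ} (hg : Tendsto g atTop (𝓝 c))
    (h : ∀ᶠ n in atTop, g n ≤ f n) : (c : EReal) ≤ liminf (fun n => (f n : EReal)) atTop := by
  have h1 : Tendsto (fun n => (g n : EReal)) atTop (𝓝 (c : EReal)) :=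
    (continuous_coe_real_ereal.tendsto c).comp hg
  rw [← h1.liminf_eq]
  exact liminf_le_liminf (h.mono fun n hn => EReal.coe_le_coe_iff.2 hn)

theorem le_mul_of_ceil_div_le {n q r : ℕ} (hq : 0 < q) (h : ⌈(n : ℝ) / q⌉₊ ≤ r) : n ≤ q * r := by
  have hq0 : (0 : ℝ) < q := by exact_mod_cast hq
  have h1 : (n : ℝ) / q ≤ r := (Nat.le_ceil _).trans (by exact_mod_cast h)
  rw [div_le_iff₀ hq0] at h1
  rw [mul_comm]
  exact_mod_cast h1

theorem ceil_div_le_self {n q : ℕ} (hq : 0 < q) : ⌈(n : ℝ) / q⌉₊ ≤ n :=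
  Nat.ceil_le.2 (div_le_self (by positivity) (by exact_mod_cast hq))

theorem entropyBase_one_sub_inv {q : ℕ} (hq : 2 ≤ q) :
    entropyBase q (1 - (q : ℝ)⁻¹) = 1 := by
  have hq2 : (2 : ℝ) ≤ q := by exact_mod_cast hq
  have hl : Real.log (q : ℝ) ≠ 0 := (Real.log_pos (by linarith)).ne'
  have h1 : 1 - (q : ℝ)⁻¹ = (q - 1) / q := by field_simp
  rw [entropyBase, Real.qaryEntropy, div_eq_one_iff_eq hl, Real.binEntropy_one_sub,
    Real.binEntropy_eq_negMulLog_add_negMulLog_one_sub, Real.negMulLog, Real.negMulLog, h1,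
    Real.log_div (by linarith) (by linarith), Real.log_inv]
  push_cast
  field_simp
  ring

/-- The argument `δ / ((1 - δ) (q - 1))` is the critical point of `z ↦ δ log z - log (1 + (q - 1)
z)`, the exponent in the Gilbert–Varshamov bound. -/
theorem mul_log_sub_log_eq_neg_entropy {q : ℕ} {δ : ℝ} (hq : 2 ≤ q) (hδ : 0 < δ) (hδ1 : δ < 1) :
    δ * Real.log (δ / ((1 - δ) * ((q : ℝ) - 1)))
      - Real.log (1 + ((q : ℝ) - 1) * (δ / ((1 - δ) * ((q : ℝ) - 1))))
      = -Real.qaryEntropy q δ := by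
  have hq2 : (2 : ℝ) ≤ q := by exact_mod_cast hq
  have h1 : (0 : ℝ) < q - 1 := by linarith
  have h2 : 0 < 1 - δ := by linarith
  have h3 : 1 + ((q : ℝ) - 1) * (δ / ((1 - δ) * ((q : ℝ) - 1))) = (1 - δ)⁻¹ := by
    field_simp; ring
  rw [h3, Real.log_inv, Real.log_div hδ.ne' (by positivity), Real.log_mul h2.ne' h1.ne',
    Real.qaryEntropy, Real.binEntropy_eq_negMulLog_add_negMulLog_one_sub, Real.negMulLog,
    Real.negMulLog]
  push_cast
  ring

/-- Over a fixed alphabet, the rates of optimal constant symbol weight codes are eventually bounded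
below by a sequence that converges to the difference of entropies. -/
theorem exists_tendsto_le_codeRate_of_const_alphabet {q : ℕ} {δ ρ : ℝ} {d r : ℕ → ℕ}
    (hq : 2 ≤ q) (hδ : 0 < δ) (hδq : δ ≤ ((q : ℝ) - 1) / q)
    (hd : Tendsto (fun n => (d n : ℝ) / n) atTop (𝓝 δ))
    (hqr : ∀ᶠ n : ℕ in atTop, n ≤ q * r n) (hrn : ∀ᶠ n : ℕ in atTop, r n ≤ n)
    (hr : Tendsto (fun n => (r n : ℝ) / n) atTop (𝓝 ρ)) :
    ∃ g : ℕ → ℝ, Tendsto g atTop (𝓝 (entropyBase q (1 - ρ) - entropyBase q δ)) ∧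
      ∀ᶠ n in atTop, g n ≤ codeRate q n (constSWMax q n (d n) (r n)) ∧
        0 < constSWMax q n (d n) (r n) := by
  have hq2 : (2 : ℝ) ≤ q := by exact_mod_cast hq
  have hs : (0 : ℝ) < q - 1 := by linarith
  have hδ1 : δ < 1 := hδq.trans_lt (by rw [div_lt_one (by linarith)]; linarith)
  have h1δ : 0 < 1 - δ := by linarith
  set z : ℝ := δ / ((1 - δ) * ((q : ℝ) - 1)) with hzdef
  have hz : 0 < z := by positivity
  -- This is equivalent to `δ ≤ (q - 1) / q`.
  have hz1 : z ≤ 1 := by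
    rw [hzdef, div_le_one (by positivity)]
    rw [le_div_iff₀ (by linarith)] at hδq
    linarith
  refine ⟨fun n => (Real.binEntropy (r n / n) + (1 - (r n : ℝ) / n) * Real.log ((q : ℝ) - 1)
      - (2 * ((q : ℝ) - 1) + 1) / n - Real.log (1 * (n : ℝ) + 1) / n
      - ((q : ℝ) - 1) * (Real.log (((q : ℝ) - 1)⁻¹ * n + 2) / n)
      + (d n : ℝ) / n * Real.log z - Real.log (1 + ((q : ℝ) - 1) * z)) / Real.log q, ?_, ?_⟩
  · have hlim : entropyBase q (1 - ρ) - entropyBase q δ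
        = (Real.binEntropy ρ + (1 - ρ) * Real.log ((q : ℝ) - 1) - 0 - 0
          - ((q : ℝ) - 1) * 0 + δ * Real.log z - Real.log (1 + ((q : ℝ) - 1) * z))
          / Real.log q := by
      have := mul_log_sub_log_eq_neg_entropy hq hδ hδ1
      rw [← hzdef] at this
      rw [entropyBase, entropyBase, ← sub_div]
      congr 1
      have h2 : Real.qaryEntropy q (1 - ρ)
          = (1 - ρ) * Real.log ((q : ℝ) - 1) + Real.binEntropy ρ := by
        rw [Real.qaryEntropy, Real.binEntropy_one_sub]
        push_cast
        ring
      linarith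
    rw [hlim]
    refine Tendsto.div_const ?_ _
    refine ((((((((Real.binEntropy_continuous.tendsto ρ).comp hr).add
      ((hr.const_sub 1).mul_const _)).sub ?_).sub ?_).sub ?_).add
      (hd.mul_const _)).sub_const _)
    · exact tendsto_const_nhds.div_atTop tendsto_natCast_atTop_atTop
    · exact tendsto_log_mul_add_div_atTop one_pos 1
    · exact (tendsto_log_mul_add_div_atTop (inv_pos.2 hs) 2).const_mul _
  · filter_upwards [hqr, hrn, eventually_gt_atTop 0] with n h1 h2 hn
    obtain ⟨h3, h4⟩ := codeRate_constSWMax_ge (d := d n) hq hn h2 h1 hz hz1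
    refine ⟨le_of_eq_of_le ?_ h3, h4⟩
    have hn0 : (0 : ℝ) < n := by exact_mod_cast hn
    have hlq : 0 < Real.log (q : ℝ) := Real.log_pos (by linarith)
    rw [one_mul, inv_mul_eq_div]
    field_simp
    ring

/-! ### Growing alphabet. -/

theorem codeRate_constSWMax_ge_of_le_mul {q n d r : ℕ} {M : ℝ} (hq : 2 ≤ q) (hn0 : 0 < n)
    (hr : r ≤ n) (hn : n ≤ q * r) (hM : (q : ℝ) ≤ M * n) :
    1 - (r : ℝ) / n - (d : ℝ) / n - (3 * M + 4) / Real.log q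
      ≤ codeRate q n (constSWMax q n d r) ∧ 0 < constSWMax q n d r := by
  have hq2 : (2 : ℝ) ≤ q := by exact_mod_cast hq
  have hs : (0 : ℝ) < q - 1 := by linarith
  have hn0' : (0 : ℝ) < n := by exact_mod_cast hn0
  have hlq : 0 < Real.log (q : ℝ) := Real.log_pos (by linarith)
  have hr0 : (0 : ℝ) ≤ r := by positivity
  have hrn : (r : ℝ) ≤ n := by exact_mod_cast hr
  obtain ⟨h3, h4⟩ := codeRate_constSWMax_ge (d := d) hq hn0 hr hn (z := (q : ℝ)⁻¹)
    (by positivity) (inv_le_one_of_one_le₀ (by linarith))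
  refine ⟨le_trans ?_ h3, h4⟩
  rw [le_div_iff₀ (by positivity)]
  have hlhs : (1 - (r : ℝ) / n - (d : ℝ) / n - (3 * M + 4) / Real.log q) * (n * Real.log q)
      = ((n : ℝ) - r) * Real.log q - d * Real.log q - (3 * (M * n) + 4 * n) := by
    field_simp
  rw [hlhs, Real.log_inv]
  have hl2 : Real.log 2 ≤ 1 := by linarith [Real.log_le_sub_one_of_pos (two_pos (α := ℝ))]
  have hl2' : 0 ≤ Real.log 2 := Real.log_nonneg (by norm_num)
  have e1 : 0 ≤ n * Real.binEntropy (r / n) :=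
    mul_nonneg hn0'.le (Real.binEntropy_nonneg (by positivity) (div_le_one_of_le₀ hrn hn0'.le))
  have e2 : ((n : ℝ) - r) * Real.log q - n ≤ ((n : ℝ) - r) * Real.log ((q : ℝ) - 1) := by
    have h5 : Real.log q ≤ Real.log 2 + Real.log ((q : ℝ) - 1) := by
      rw [← Real.log_mul two_ne_zero hs.ne']
      exact Real.log_le_log (by linarith) (by linarith)
    nlinarith
  have e3 : Real.log ((n : ℝ) + 1) ≤ n := by
    linarith [Real.log_le_sub_one_of_pos (by positivity : (0 : ℝ) < n + 1)]
  have e4 : ((q : ℝ) - 1) * Real.log (n / ((q : ℝ) - 1) + 2) ≤ n + (q - 1) := by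
    have h5 := Real.log_le_sub_one_of_pos (by positivity : (0 : ℝ) < n / ((q : ℝ) - 1) + 2)
    calc _ ≤ ((q : ℝ) - 1) * (n / ((q : ℝ) - 1) + 2 - 1) := mul_le_mul_of_nonneg_left h5 hs.le
      _ = _ := by field_simp; ring
  have e5 : n * Real.log (1 + ((q : ℝ) - 1) * (q : ℝ)⁻¹) ≤ n := by
    have h6 : ((q : ℝ) - 1) * (q : ℝ)⁻¹ ≤ 1 := by
      rw [← div_eq_mul_inv, div_le_one (by linarith)]; linarith
    have h7 : 0 < ((q : ℝ) - 1) * (q : ℝ)⁻¹ := by positivity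
    have h5 := Real.log_le_sub_one_of_pos (by linarith : 0 < 1 + ((q : ℝ) - 1) * (q : ℝ)⁻¹)
    nlinarith
  -- The losses total `3 (q - 1) + 1 + 4 n ≤ 3 M n + 4 n`, whence the constant `3 M + 4`.
  linarith

/-- For an alphabet growing at most linearly, the rates of optimal constant symbol weight codes are
eventually bounded below by a sequence that converges to `1 - ρ - δ`. -/
theorem exists_tendsto_le_codeRate_of_growing_alphabet {δ ρ M : ℝ} {q d r : ℕ → ℕ}
    (hq : Tendsto q atTop atTop) (hM : ∀ᶠ n in atTop, (q n : ℝ) ≤ M * n)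
    (hd : Tendsto (fun n => (d n : ℝ) / n) atTop (𝓝 δ))
    (hqr : ∀ᶠ n : ℕ in atTop, n ≤ q n * r n) (hrn : ∀ᶠ n : ℕ in atTop, r n ≤ n)
    (hr : Tendsto (fun n => (r n : ℝ) / n) atTop (𝓝 ρ)) :
    ∃ g : ℕ → ℝ, Tendsto g atTop (𝓝 (1 - ρ - δ)) ∧
      ∀ᶠ n in atTop, g n ≤ codeRate (q n) n (constSWMax (q n) n (d n) (r n)) ∧
        0 < constSWMax (q n) n (d n) (r n) := by
  refine ⟨fun n => 1 - (r n : ℝ) / n - (d n : ℝ) / n - (3 * M + 4) / Real.log (q n), ?_, ?_⟩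
  · have h := ((hr.const_sub 1).sub hd).sub
      (tendsto_const_nhds (x := 3 * M + 4).div_atTop
        (Real.tendsto_log_atTop.comp (tendsto_natCast_atTop_atTop.comp hq)))
    simpa using h
  · filter_upwards [hqr, hrn, hM, hq.eventually_ge_atTop 2, eventually_gt_atTop 0]
      with n h1 h2 h3 h4 h5
    exact codeRate_constSWMax_ge_of_le_mul h4 h5 h2 h1 h3

theorem tendsto_codeRate_of_le {δ : ℝ} {q d : ℕ → ℕ} {S : ∀ n, Finset (Fin n → Fin (q n))}
    {g : ℕ → ℝ} (hq : Tendsto q atTop atTop) (hδ : δ ≤ 1)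
    (hd : Tendsto (fun n => (d n : ℝ) / n) atTop (𝓝 δ)) (hg : Tendsto g atTop (𝓝 (1 - δ)))
    (h : ∀ᶠ n in atTop, g n ≤ codeRate (q n) n (maxCodeSize (S n) (d n)) ∧
      0 < maxCodeSize (S n) (d n)) :
    Tendsto (fun n => codeRate (q n) n (maxCodeSize (S n) (d n))) atTop (𝓝 (1 - δ)) := by
  have hup : Tendsto (fun n : ℕ => max 0 (1 - (d n : ℝ) / n + 1 / n)) atTop (𝓝 (1 - δ)) := by
    have h1 := (tendsto_const_nhds (x := (0 : ℝ))).max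
      ((hd.const_sub 1).add (tendsto_one_div_atTop_nhds_zero_nat (𝕜 := ℝ)))
    rwa [add_zero, max_eq_right (by linarith)] at h1
  refine tendsto_of_tendsto_of_tendsto_of_le_of_le' hg hup (h.mono fun n hn => hn.1) ?_
  filter_upwards [h, hq.eventually_ge_atTop 2, eventually_gt_atTop 0] with n h1 h2 h3
  exact codeRate_maxCodeSize_le h2 h3 _ h1.2

theorem tendsto_ceil_div_div {q : ℕ → ℕ} {c : ℝ}
    (hq : Tendsto (fun n => ((q n : ℝ))⁻¹) atTop (𝓝 c)) :
    Tendsto (fun n : ℕ => (⌈(n : ℝ) / q n⌉₊ : ℝ) / n) atTop (𝓝 c) := by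
  have hup : Tendsto (fun n : ℕ => ((q n : ℝ))⁻¹ + 1 / (n : ℝ)) atTop (𝓝 c) := by
    simpa using hq.add (tendsto_one_div_atTop_nhds_zero_nat (𝕜 := ℝ))
  refine tendsto_of_tendsto_of_tendsto_of_le_of_le' hq hup ?_ ?_
  · filter_upwards [eventually_gt_atTop 0] with n hn
    have hn0 : (0 : ℝ) < n := by exact_mod_cast hn
    rw [le_div_iff₀ hn0, inv_mul_eq_div]
    exact Nat.le_ceil _
  · filter_upwards [eventually_gt_atTop 0] with n hn
    have hn0 : (0 : ℝ) < n := by exact_mod_cast hn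
    have h1 := (Nat.ceil_lt_add_one (by positivity : (0 : ℝ) ≤ (n : ℝ) / q n)).le
    calc _ ≤ ((n : ℝ) / q n + 1) / n := div_le_div_of_nonneg_right h1 hn0.le
      _ = _ := by field_simp

theorem theorem2 :
    -- constant alphabet size
    (∀ (q : ℕ) (δ : ℝ) (d r : ℕ → ℕ),
      2 ≤ q →
      0 < δ → δ ≤ ((q : ℝ) - 1) / q →
      Tendsto (fun n => (d n : ℝ) / n) atTop (𝓝 δ) →
      (∀ᶠ n : ℕ in atTop, ⌈(n : ℝ) / q⌉₊ ≤ r n) →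
        (∀ ρ : ℝ,
          (∀ᶠ n : ℕ in atTop, r n ≤ n) →
          Tendsto (fun n => (r n : ℝ) / n) atTop (𝓝 ρ) →
          ((entropyBase q (1 - ρ) - entropyBase q δ : ℝ) : EReal) ≤
            liminf (fun n => (codeRate q n (constSWMax q n (d n) (r n)) : EReal)) atTop) ∧
        ((1 - entropyBase q δ : ℝ) : EReal) ≤
          liminf (fun n => (codeRate q n (boundedSWMax q n (d n) (r n)) : EReal)) atTop) ∧
    -- alphabet size growing as `θ n ^ ε`
    (∀ (θ ε δ : ℝ) (q d r : ℕ → ℕ),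
      0 < θ → 0 < ε → ε ≤ 1 →
      (fun n => (q n : ℝ)) ~[atTop] (fun n : ℕ => θ * (n : ℝ) ^ ε) →
      0 < δ → δ ≤ 1 →
      Tendsto (fun n => (d n : ℝ) / n) atTop (𝓝 δ) →
      (∀ᶠ n : ℕ in atTop, ⌈(n : ℝ) / q n⌉₊ ≤ r n) →
        (∀ ρ : ℝ,
          (∀ᶠ n : ℕ in atTop, r n ≤ n) →
          Tendsto (fun n => (r n : ℝ) / n) atTop (𝓝 ρ) →
          ((1 - ρ - δ : ℝ) : EReal) ≤
            liminf (fun n => (codeRate (q n) n (constSWMax (q n) n (d n) (r n)) : EReal))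
              atTop) ∧
        ((fun n => (r n : ℝ)) =o[atTop] (fun n : ℕ => (n : ℝ)) →
          Tendsto (fun n => codeRate (q n) n (constSWMax (q n) n (d n) (r n))) atTop
            (𝓝 (1 - δ))) ∧
        Tendsto (fun n => codeRate (q n) n (boundedSWMax (q n) n (d n) (r n))) atTop
          (𝓝 (1 - δ))) := by
  refine ⟨fun q δ d r hq hδ hδq hd hqr => ⟨fun ρ hrn hr => ?_, ?_⟩,
    fun θ ε δ q d r hθ hε hε1 hq _ hδ1 hd hqr => ?_⟩
  · obtain ⟨g, hg, h⟩ := exists_tendsto_le_codeRate_of_const_alphabet hq hδ hδq hd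
      (hqr.mono fun n hn => le_mul_of_ceil_div_le (by omega) hn) hrn hr
    exact coe_le_liminf_of_tendsto hg (h.mono fun n hn => hn.1)
  -- The least admissible weight `⌈n / q⌉` replaces `r`, so `r n / n` need not converge; with `ρ = 1
  -- / q` the entropy term is `1`.
  · obtain ⟨g, hg, h⟩ := exists_tendsto_le_codeRate_of_const_alphabet hq hδ hδq hd
      (r := fun n => ⌈(n : ℝ) / q⌉₊) (ρ := (q : ℝ)⁻¹)
      (.of_forall fun n => le_mul_of_ceil_div_le (by omega) le_rfl)
      (.of_forall fun n => ceil_div_le_self (by omega))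
      (tendsto_ceil_div_div (q := fun _ => q) tendsto_const_nhds)
    rw [entropyBase_one_sub_inv hq] at hg
    refine coe_le_liminf_of_tendsto hg ?_
    filter_upwards [h, hqr] with n h1 h2
    exact h1.1.trans (codeRate_mono hq h1.2 (constSWMax_le_boundedSWMax h2))
  · have hqtop : Tendsto q atTop atTop := by
      rw [← tendsto_natCast_atTop_iff (R := ℝ)]
      exact hq.symm.tendsto_atTop
        (((tendsto_rpow_atTop hε).comp tendsto_natCast_atTop_atTop).const_mul_atTop hθ)
    -- Here `ε ≤ 1` enters: the error terms of order `q` stay `O(n)`.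
    obtain ⟨M, hM⟩ : ∃ M : ℝ, ∀ᶠ n in atTop, (q n : ℝ) ≤ M * n := by
      obtain ⟨c, hc⟩ := hq.isBigO.bound
      refine ⟨|c| * θ, ?_⟩
      filter_upwards [hc, eventually_ge_atTop 1] with n hn h1
      have hn1 : (1 : ℝ) ≤ n := by exact_mod_cast h1
      have h2 : (n : ℝ) ^ ε ≤ n := by
        simpa using Real.rpow_le_rpow_of_exponent_le hn1 hε1
      have h3 : (0 : ℝ) ≤ θ * (n : ℝ) ^ ε := by positivity
      rw [Real.norm_of_nonneg (by positivity), Real.norm_of_nonneg h3] at hn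
      calc (q n : ℝ) ≤ c * (θ * (n : ℝ) ^ ε) := hn
        _ ≤ |c| * (θ * n) := by gcongr; exact le_abs_self c
        _ = |c| * θ * n := by ring
    have hpos : ∀ᶠ n in atTop, 0 < q n := hqtop.eventually_gt_atTop 0
    have hqr' : ∀ᶠ n : ℕ in atTop, n ≤ q n * r n := by
      filter_upwards [hqr, hpos] with n h1 h2
      exact le_mul_of_ceil_div_le h2 h1
    refine ⟨fun ρ hrn hr => ?_, fun hro => ?_, ?_⟩
    · obtain ⟨g, hg, h⟩ := exists_tendsto_le_codeRate_of_growing_alphabet hqtop hM hd hqr' hrn hr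
      exact coe_le_liminf_of_tendsto hg (h.mono fun n hn => hn.1)
    · have hrn : ∀ᶠ n : ℕ in atTop, r n ≤ n := by
        filter_upwards [hro.bound one_pos] with n hn
        simpa using hn
      obtain ⟨g, hg, h⟩ := exists_tendsto_le_codeRate_of_growing_alphabet hqtop hM hd hqr' hrn
        hro.tendsto_div_nhds_zero
      rw [sub_zero] at hg
      exact tendsto_codeRate_of_le hqtop hδ1 hd hg h
    · obtain ⟨g, hg, h⟩ := exists_tendsto_le_codeRate_of_growing_alphabet hqtop hM hd
        (r := fun n => ⌈(n : ℝ) / q n⌉₊) (ρ := 0)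
        (hpos.mono fun n hn => le_mul_of_ceil_div_le hn le_rfl)
        (hpos.mono fun n hn => ceil_div_le_self hn)
        (tendsto_ceil_div_div
          (tendsto_inv_atTop_zero.comp (tendsto_natCast_atTop_atTop.comp hqtop)))
      rw [sub_zero] at hg
      refine tendsto_codeRate_of_le hqtop hδ1 hd hg ?_
      filter_upwards [h, hqr, hqtop.eventually_ge_atTop 2] with n h1 h2 h3
      have hle := constSWMax_le_boundedSWMax (q := q n) (n := n) (d := d n) h2
      exact ⟨h1.1.trans (codeRate_mono h3 h1.2 hle), h1.2.trans_le hle⟩
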